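/- Let $X$ and $Y$ be compact Hausdorff spaces. For $f\in C(X)$, $g\in C(Y)$ (complex-valued continuous functions) write $(f\otimes g)(x,y)=f(x)g(y)$, and let $B\otimes C(Y)$ be the set of finite sums of functions $f\otimes g$ with $f\in B$, $g\in C(Y)$. A unital subalgebra $A$ of $C(K)$, $K$ compact Hausdorff, equipped with a Banach algebra norm is called self-adjoint if $f\in A$ implies $\bar f\in A$ and if $x\mapsto(f\mapsto f(x))$ is a bijection from $K$ onto the maximal ideal space of $A$. Let $B$ be a unital point separating subalgebra of $C(X)$ with a Banach algebra norm $\|\cdot\|_B$, and $\widetilde B$ a unital point separating subalgebra of $C(X\times Y)$ with a Banach algebra norm $\|\cdot\|_{\widetilde B}$, both self-adjoint, such that $B\otimes C(Y)\subset\widetilde B$. Then $\widetilde B$ is called a natural $C(Y)$-valuezation of $B$ if there are a compact Hausdorff space $\mathfrak M$ and a complex-linear map $D:\widetilde B\to C(\mathfrak M)$ such that $\ker D=\{1\otimes g: g\in C(Y)\}$, $D$ maps real-valued functions to real-valued functions, and $$\|F\|_{\widetilde B}=\sup_{X\times Y}|F|+\sup_{\mathfrak M}|D(F)|\qquad(F\in\widetilde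 B).$$ Proposition. For $j=1,2$ let $X_j,Y_j$ be compact Hausdorff spaces and let $\widetilde B_j$ be a natural $C(Y_j)$-valuezation of $B_j\subset C(X_j)$, where $X_2$ is not a singleton. Let $U:\widetilde B_1\to\widetilde B_2$ be a surjective complex-linear isometry with respect to the norms $\|\cdot\|_{\widetilde B_1}$, $\|\cdot\|_{\widetilde B_2}$. Then there exists $h\in C(Y_2)$ with $|h|=1$ on $Y_2$ such that $U(1)=1\otimes h$. -/

import Mathlib

open Filter Topology

universe w u v w₁ w₂ u₁ v₁ u₂ v₂

namespace Valuezation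

section

variable {X Y : Type*} [TopologicalSpace X] [TopologicalSpace Y]

/-- The function `f ⊗ g` on `X × Y`, `(f ⊗ g)(x, y) = f x * g y`. -/
noncomputable def tensor (f : C(X, ℂ)) (g : C(Y, ℂ)) : C(X × Y, ℂ) :=
  ⟨fun p => f p.1 * g p.2, by fun_prop⟩

/-- The space of finite sums of functions `f ⊗ g` with `f ∈ E` and `g ∈ F`. -/
noncomputable def tensorSpace (E : Submodule ℂ C(X, ℂ)) (F : Submodule ℂ C(Y, ℂ)) :
    Submodule ℂ C(X × Y, ℂ) :=
  Submodule.span ℂ {k | ∃ f ∈ E, ∃ g ∈ F, k = tensor f g}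

/-- Evaluation at a point `x`, as a complex homomorphism of an algebra of functions on `X`. -/
noncomputable def evalHom (A : Subalgebra ℂ C(X, ℂ)) (x : X) : A →ₐ[ℂ] ℂ where
  toFun f := (f : C(X, ℂ)) x
  map_one' := rfl
  map_mul' _ _ := rfl
  map_zero' := rfl
  map_add' _ _ := rfl
  commutes' _ := rfl

/-- The algebra is natural: the point evaluations are pairwise distinct and exhaust the maximal
ideal space. The maximal ideal space is taken as the set of all unital complex homomorphisms;
on a Banach algebra these are automatically continuous. -/
def IsNatural (A : Subalgebra ℂ C(X, ℂ)) : Prop :=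
  Function.Bijective (evalHom A)

/-- The algebra is self-adjoint: natural and closed under complex conjugation. -/
def IsSelfAdjointAlgebra (A : Subalgebra ℂ C(X, ℂ)) : Prop :=
  IsNatural A ∧ ∀ f ∈ A, star f ∈ A

/-- Completeness of an algebra of functions for a given algebra norm `N` (which is unrelated to
the supremum norm that the algebra inherits from `C(X, ℂ)`). -/
def IsCompleteNorm {A : Subalgebra ℂ C(X, ℂ)} (N : AlgebraNorm ℂ A) : Prop :=
  ∀ u : ℕ → A, (∀ ε : ℝ, 0 < ε → ∃ n₀ : ℕ, ∀ m ≥ n₀, ∀ n ≥ n₀, N (u m - u n) < ε) →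
    ∃ a : A, Tendsto (fun n => N (u n - a)) atTop (𝓝 0)

/-- A unital, point separating, self-adjoint subalgebra of `C(X, ℂ)` for which `N` is a Banach
algebra norm. -/
structure IsSelfAdjointBanachAlgebra (A : Subalgebra ℂ C(X, ℂ)) (N : AlgebraNorm ℂ A) : Prop where
  separatesPoints : A.SeparatesPoints
  complete : IsCompleteNorm N
  selfAdjoint : IsSelfAdjointAlgebra A

end

/-- `W`, with the norm `NW`, is a natural `C(Y)`-valuezation of `B`, with the norm `NB`.
The auxiliary compact space `M` may live in any universe `w`. -/
structure IsNaturalValuezation {X : Type u} {Y : Type v}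
    [TopologicalSpace X] [CompactSpace X] [T2Space X]
    [TopologicalSpace Y] [CompactSpace Y] [T2Space Y]
    (B : Subalgebra ℂ C(X, ℂ)) (NB : AlgebraNorm ℂ B)
    (W : Subalgebra ℂ C(X × Y, ℂ)) (NW : AlgebraNorm ℂ W) : Prop where
  base : IsSelfAdjointBanachAlgebra B NB
  total : IsSelfAdjointBanachAlgebra W NW
  tensor_le : tensorSpace (Subalgebra.toSubmodule B) (⊤ : Submodule ℂ C(Y, ℂ)) ≤
    Subalgebra.toSubmodule W
  exists_map : ∃ (M : Type w) (_ : TopologicalSpace M) (_ : CompactSpace M) (_ : T2Space M)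
    (D : W →ₗ[ℂ] C(M, ℂ)),
    (∀ F : W, D F = 0 ↔ ∃ g : C(Y, ℂ), (F : C(X × Y, ℂ)) = tensor 1 g) ∧
    (∀ F : W, (∀ p, ((F : C(X × Y, ℂ)) p).im = 0) → ∀ m, (D F m).im = 0) ∧
    (∀ F : W, NW F = ‖(F : C(X × Y, ℂ))‖ + ‖D F‖)

end Valuezation

/-!
Surjective linear isometries carry spear vectors to spear vectors, and `1` is a spear vector for
the norm `‖F‖ + ‖D F‖` whenever `D 1 = 0`. So everything rests on the claim that a spear vector `u`
of such a norm satisfies `D u = 0` if `D` respects real functions.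

Suppose `D u ≠ 0` and rotate `u` so that `D u` takes the value `‖D u‖`. If `D G = Re (D u)`, then
already the alignment of `D G` with `c • D u` forces the unimodular factor `c` to be `1`, whence `G`
and `u` themselves are aligned for the supremum norm. Taking `G = Re u` shows that `|Re u|` reaches
`‖u‖`; taking `G = Re u + i`, whose modulus is largest where `|Re u|` is, then shows that a real
nonzero value of `u` is a positive multiple of a non-real number.
-/

namespace Valuezation

section Alignment

variable {K E : Type*} [TopologicalSpace K] [CompactSpace K] [Nonempty K] [NormedAddCommGroup E]

theorem exists_norm_apply_eq_norm (f : C(K, E)) : ∃ p, ‖f p‖ = ‖f‖ := by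
  obtain ⟨p, -, hp⟩ := isCompact_univ.exists_isMaxOn Set.univ_nonempty
    f.continuous.norm.continuousOn
  exact ⟨p, le_antisymm (f.norm_coe_le_norm p)
    ((f.norm_le_of_nonempty).2 fun q => hp (Set.mem_univ q))⟩

theorem exists_sameRay_of_norm_add_eq [NormedSpace ℝ E] [StrictConvexSpace ℝ E] {f g : C(K, E)}
    (h : ‖f + g‖ = ‖f‖ + ‖g‖) :
    ∃ p, ‖f p‖ = ‖f‖ ∧ ‖g p‖ = ‖g‖ ∧ SameRay ℝ (f p) (g p) := by
  obtain ⟨p, hp⟩ := exists_norm_apply_eq_norm (f + g)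
  rw [h, ContinuousMap.add_apply] at hp
  have hf := f.norm_coe_le_norm p
  have hg := g.norm_coe_le_norm p
  have htri := norm_add_le (f p) (g p)
  exact ⟨p, by linarith, by linarith, sameRay_iff_norm_add.2 (by linarith)⟩

end Alignment

section Spear

variable {V V' E : Type*}

/-- Spear vectors of a complex seminormed space, without the customary normalisation `p u = 1`:
every vector becomes aligned with `u` after multiplying `u` by a suitable unimodular number. -/
def IsSpear [AddCommGroup V] [Module ℂ V] (p : Seminorm ℂ V) (u : V) : Prop :=
  ∀ G : V, ∃ c : ℂ, ‖c‖ = 1 ∧ p (G + c • u) = p G + p u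

section Seminorm

variable [AddCommGroup V] [Module ℂ V] [AddCommGroup V'] [Module ℂ V']
  {p : Seminorm ℂ V} {q : Seminorm ℂ V'} {u : V}

theorem IsSpear.smul (h : IsSpear p u) {z : ℂ} (hz : ‖z‖ = 1) : IsSpear p (z • u) := by
  intro G
  have hz0 : z ≠ 0 := norm_ne_zero_iff.1 (by simp [hz])
  obtain ⟨c, hc, hG⟩ := h G
  refine ⟨c * z⁻¹, by simp [hc, hz], ?_⟩
  rw [smul_smul, inv_mul_cancel_right₀ hz0, hG, map_smul_eq_mul, hz, one_mul]

theorem IsSpear.map (h : IsSpear p u) {U : V →ₗ[ℂ] V'} (hU : Function.Surjective U)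
    (hiso : ∀ F, q (U F) = p F) : IsSpear q (U u) := by
  intro G
  obtain ⟨F, rfl⟩ := hU G
  obtain ⟨c, hc, hF⟩ := h F
  exact ⟨c, hc, by rw [← map_smul, ← map_add, hiso, hiso, hiso, hF]⟩

theorem IsSpear.of_map {ι : V →ₗ[ℂ] V'} (hι : ∀ F, q (ι F) = p F) (h : IsSpear q (ι u)) :
    IsSpear p u := by
  intro G
  obtain ⟨c, hc, hG⟩ := h (ι G)
  exact ⟨c, hc, by rw [← hι, ← hι, ← hι, map_add, map_smul, hG]⟩

end Seminorm

variable [SeminormedAddCommGroup V] [NormedSpace ℂ V] [SeminormedAddCommGroup E] [NormedSpace ℂ E]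

/-- The graph norm `‖F‖ + ‖D F‖` of a linear map `D`. For `V` a space of functions with the
supremum norm and `E = C(𝔐)`, this is the norm of a natural valuezation. -/
noncomputable def graphNorm (D : V →ₗ[ℂ] E) : Seminorm ℂ V :=
  normSeminorm ℂ V + (normSeminorm ℂ E).comp D

theorem graphNorm_apply (D : V →ₗ[ℂ] E) (F : V) : graphNorm D F = ‖F‖ + ‖D F‖ := rfl

theorem graphNorm_of_map_eq_zero {D : V →ₗ[ℂ] E} {F : V} (hF : D F = 0) :
    graphNorm D F = ‖F‖ := by
  rw [graphNorm_apply, hF, norm_zero, add_zero]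

theorem isSpear_graphNorm_of_map_eq_zero {D : V →ₗ[ℂ] E} {u : V}
    (h : IsSpear (normSeminorm ℂ V) u) (hu : D u = 0) : IsSpear (graphNorm D) u := by
  intro G
  obtain ⟨c, hc, hG⟩ := h G
  simp only [coe_normSeminorm] at hG
  refine ⟨c, hc, ?_⟩
  simp only [graphNorm_apply, map_add, map_smul, hu, smul_zero, add_zero, norm_zero, hG]
  ring

theorem IsSpear.exists_norm_add_smul_eq {D : V →ₗ[ℂ] E} {u : V} (h : IsSpear (graphNorm D) u)
    (G : V) : ∃ c : ℂ, ‖c‖ = 1 ∧ ‖G + c • u‖ = ‖G‖ + ‖c • u‖ ∧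
      ‖D G + c • D u‖ = ‖D G‖ + ‖c • D u‖ := by
  obtain ⟨c, hc, hG⟩ := h G
  simp only [graphNorm_apply, map_add, map_smul] at hG
  have hV := norm_add_le G (c • u)
  have hE := norm_add_le (D G) (c • D u)
  have hcu : ‖c • u‖ = ‖u‖ := by rw [norm_smul, hc, one_mul]
  have hcD : ‖c • D u‖ = ‖D u‖ := by rw [norm_smul, hc, one_mul]
  exact ⟨c, hc, by linarith, by linarith⟩

end Spear

section SupNorm

variable {K : Type*} [TopologicalSpace K] [CompactSpace K]

theorem isSpear_one : IsSpear (normSeminorm ℂ C(K, ℂ)) 1 := by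
  intro F
  simp only [coe_normSeminorm]
  rcases isEmpty_or_nonempty K with _ | _
  · exact ⟨1, norm_one, by simp [Subsingleton.elim F 0, Subsingleton.elim (1 : C(K, ℂ)) 0]⟩
  obtain ⟨p, hp⟩ := exists_norm_apply_eq_norm F
  obtain ⟨c, hc, hFc⟩ := Complex.exists_norm_mul_eq_self (F p)
  have hFp : ‖(F + c • 1) p‖ = ‖F‖ + 1 := by
    have : (F + c • 1) p = c * ((‖F‖ + 1 : ℝ) : ℂ) := by
      rw [← hp]
      simp [mul_add, hFc]
    rw [this, norm_mul, hc, one_mul, Complex.norm_of_nonneg (by positivity)]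
  refine ⟨c, hc, le_antisymm ?_ ?_⟩
  · simpa [norm_smul, hc] using norm_add_le F (c • 1)
  · rw [norm_one, ← hFp]
    exact (F + c • 1).norm_coe_le_norm p

theorem isSpear_graphNorm_one {E : Type*} [SeminormedAddCommGroup E] [NormedSpace ℂ E]
    {W : Submodule ℂ C(K, ℂ)} {D : W →ₗ[ℂ] E} (hone : 1 ∈ W) (hD : D ⟨1, hone⟩ = 0) :
    IsSpear (graphNorm D) ⟨1, hone⟩ :=
  isSpear_graphNorm_of_map_eq_zero (IsSpear.of_map (ι := W.subtype) (fun _ => rfl) isSpear_one) hD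

theorem IsSpear.norm_apply_eq_norm {h : C(K, ℂ)} (hh : IsSpear (normSeminorm ℂ C(K, ℂ)) h)
    (y : K) : ‖h y‖ = ‖h‖ := by
  have : Nonempty K := ⟨y⟩
  -- `g` vanishes wherever `h` attains its norm, so no multiple of `h` is aligned with a nonzero `g`
  let g : C(K, ℂ) := ⟨fun z => ((‖h‖ - ‖h z‖ : ℝ) : ℂ), by fun_prop⟩
  have hgz : ∀ z, g z = ((‖h‖ - ‖h z‖ : ℝ) : ℂ) := fun _ => rfl
  obtain ⟨c, hc, hg⟩ := hh g
  simp only [coe_normSeminorm] at hg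
  have hch : ‖c • h‖ = ‖h‖ := by rw [norm_smul, hc, one_mul]
  obtain ⟨p, hgp, hhp, -⟩ := exists_sameRay_of_norm_add_eq (hg.trans (by rw [hch]))
  have hp : ‖h p‖ = ‖h‖ := by rwa [hch, ContinuousMap.smul_apply, norm_smul, hc, one_mul] at hhp
  have hg0 : g = 0 := by
    rw [← norm_eq_zero, ← hgp, hgz, hp, sub_self, Complex.ofReal_zero, norm_zero]
  have hgy : ‖h‖ - ‖h y‖ = 0 := by
    rw [← Complex.ofReal_eq_zero, ← hgz, hg0, ContinuousMap.zero_apply]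
  linarith

end SupNorm

section RealPart

variable {K M : Type*} [TopologicalSpace K] [TopologicalSpace M]

theorem im_eq_zero_of_sameRay_re {z : ℂ} (hz : z.re ≠ 0) (h : SameRay ℝ (z.re : ℂ) z) :
    z.im = 0 := by
  simpa [hz] using congrArg Complex.im h.norm_smul_eq

theorem exists_re_map_eq_re {W : Submodule ℂ C(K, ℂ)} (hstar : ∀ f ∈ W, star f ∈ W)
    {D : W →ₗ[ℂ] C(M, ℂ)}
    (hreal : ∀ F : W, (∀ p, ((F : C(K, ℂ)) p).im = 0) → ∀ m, (D F m).im = 0) (u : W) :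
    ∃ v : W, (∀ p, (v : C(K, ℂ)) p = ((u : C(K, ℂ)) p).re) ∧ ∀ m, D v m = (D u m).re := by
  let s : W := ⟨star (u : C(K, ℂ)), hstar _ u.2⟩
  have hs : ∀ p, (s : C(K, ℂ)) p = star ((u : C(K, ℂ)) p) := fun _ => rfl
  let v : W := (1 / 2 : ℂ) • (u + s)
  let w : W := (-Complex.I / 2) • (u - s)
  have hv : ∀ p, (v : C(K, ℂ)) p = ((u : C(K, ℂ)) p).re := fun p => by
    apply Complex.ext <;> simp [v, hs]
    ring
  have hw : ∀ p, ((w : C(K, ℂ)) p).im = 0 := fun p => by simp [w, hs]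
  have huvw : u = v + Complex.I • w := by
    have hI : Complex.I * (-Complex.I / 2) = 1 / 2 := by
      linear_combination (-1 / 2 : ℂ) * Complex.I_mul_I
    simp only [v, w, smul_smul, hI]
    module
  refine ⟨v, hv, fun m => ?_⟩
  have hDv : (D v m).im = 0 := hreal v (fun p => by simp [hv]) m
  have hDw : (D w m).im = 0 := hreal w hw m
  have hDu : D u m = D v m + Complex.I * D w m := by
    conv_lhs => rw [huvw]
    simp only [map_add, map_smul, ContinuousMap.add_apply, ContinuousMap.smul_apply, smul_eq_mul]
  apply Complex.ext <;> simp [hDu, hDv, hDw]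

variable [CompactSpace K]

theorem eq_zero_of_exists_sameRay_add_I {u v : C(K, ℂ)} (hv : ∀ p, v p = (u p).re)
    (h : ∃ p, ‖v p‖ = ‖v‖ ∧ ‖u p‖ = ‖u‖ ∧ SameRay ℝ (v p) (u p))
    (hI : ∃ p, ‖(v + Complex.I • 1) p‖ = ‖v + Complex.I • 1‖ ∧ ‖u p‖ = ‖u‖ ∧
      SameRay ℝ ((v + Complex.I • 1) p) (u p)) : v = 0 := by
  by_contra hv0
  obtain ⟨p, hvp, hup, hp⟩ := h
  obtain ⟨q, hvq, huq, hq⟩ := hI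
  have hvI : ∀ x, (v + Complex.I • 1) x = (u x).re + Complex.I := fun x => by simp [hv]
  have hrep : |(u p).re| = ‖u‖ := by
    rw [← hup, Complex.abs_re_eq_norm]
    rw [hv] at hvp hp
    refine im_eq_zero_of_sameRay_re (fun h0 => hv0 (norm_eq_zero.1 ?_)) hp
    rw [← hvp, h0, Complex.ofReal_zero, norm_zero]
  have hsq : (u p).re ^ 2 ≤ (u q).re ^ 2 := by
    have hsqI : ∀ r : ℝ, ‖(r : ℂ) + Complex.I‖ ^ 2 = r ^ 2 + 1 := fun r => by
      rw [Complex.sq_norm, Complex.normSq_apply]; simp [sq]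
    have hle := (v + Complex.I • 1).norm_coe_le_norm p
    rw [← hvq, hvI, hvI] at hle
    have := pow_le_pow_left₀ (norm_nonneg _) hle 2
    rw [hsqI, hsqI] at this
    linarith
  have himq : (u q).im = 0 := Complex.abs_re_eq_norm.1
    (le_antisymm (Complex.abs_re_le_norm _) (huq ▸ hrep ▸ sq_le_sq.1 hsq))
  have hu0 : ‖u q‖ = 0 := by
    have := congrArg Complex.im hq.norm_smul_eq
    rw [hvI] at this
    simpa [himq] using this.symm
  have hu : u = 0 := norm_eq_zero.1 (huq ▸ hu0)
  exact hv0 (ContinuousMap.ext fun x => by simp [hv, hu])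

end RealPart

section GraphNorm

variable {K M : Type*} [TopologicalSpace K] [CompactSpace K] [Nonempty K]
  [TopologicalSpace M] [CompactSpace M]
  {W : Submodule ℂ C(K, ℂ)} {D : W →ₗ[ℂ] C(M, ℂ)} {u : W}

theorem IsSpear.exists_sameRay_of_map_eq_re (h : IsSpear (graphNorm D) u) (hDu : D u ≠ 0)
    {m₀ : M} (hm₀ : D u m₀ = ‖D u‖) {G : W} (hG : ∀ m, D G m = (D u m).re) :
    ∃ p, ‖(G : C(K, ℂ)) p‖ = ‖(G : C(K, ℂ))‖ ∧ ‖(u : C(K, ℂ)) p‖ = ‖(u : C(K, ℂ))‖ ∧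
      SameRay ℝ ((G : C(K, ℂ)) p) ((u : C(K, ℂ)) p) := by
  have : Nonempty M := ⟨m₀⟩
  obtain ⟨c, hc, hKc, hMc⟩ := h.exists_norm_add_smul_eq G
  obtain ⟨m, hGm, -, hm⟩ := exists_sameRay_of_norm_add_eq hMc
  have hle : ‖D u‖ ≤ ‖D G‖ := by
    simpa [hG, hm₀] using (D G).norm_coe_le_norm m₀
  have hre : |(D u m).re| = ‖D u m‖ := by
    refine le_antisymm (Complex.abs_re_le_norm _) (((D u).norm_coe_le_norm m).trans ?_)
    rwa [← hGm, hG, Complex.norm_real, Real.norm_eq_abs] at hle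
  have hDGm : D G m = D u m := by
    rw [hG]
    exact Complex.ext rfl (Complex.abs_re_eq_norm.1 hre).symm
  have hDum : D u m ≠ 0 := by
    rw [← hDGm, ← norm_pos_iff, hGm]
    exact (norm_pos_iff.2 hDu).trans_le hle
  have hc1 : c = 1 := by
    rw [hDGm, ContinuousMap.smul_apply, sameRay_iff_of_norm_eq (by rw [norm_smul, hc, one_mul])]
      at hm
    exact smul_left_injective ℂ hDum (by simpa using hm.symm)
  rw [hc1, one_smul] at hKc
  exact exists_sameRay_of_norm_add_eq hKc

theorem IsSpear.map_eq_zero (h : IsSpear (graphNorm D) u) (hone : 1 ∈ W) (hD : D ⟨1, hone⟩ = 0)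
    (hstar : ∀ f ∈ W, star f ∈ W)
    (hreal : ∀ F : W, (∀ p, ((F : C(K, ℂ)) p).im = 0) → ∀ m, (D F m).im = 0) : D u = 0 := by
  by_contra hDu
  obtain ⟨m₀, -⟩ := DFunLike.ne_iff.1 hDu
  have : Nonempty M := ⟨m₀⟩
  obtain ⟨m, hm⟩ := exists_norm_apply_eq_norm (D u)
  obtain ⟨z, hz, hzm⟩ := Complex.exists_norm_eq_mul_self (D u m)
  have hnorm : ‖D (z • u)‖ = ‖D u‖ := by rw [map_smul, norm_smul, hz, one_mul]
  have hDzu : D (z • u) ≠ 0 := by rwa [← norm_ne_zero_iff, hnorm, norm_ne_zero_iff]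
  have hmax : D (z • u) m = ‖D (z • u)‖ := by
    rw [hnorm, ← hm, hzm, map_smul, ContinuousMap.smul_apply, smul_eq_mul]
  obtain ⟨v, hv, hDv⟩ := exists_re_map_eq_re hstar hreal (z • u)
  have hDvI : ∀ x, D (v + Complex.I • ⟨1, hone⟩) x = (D (z • u) x).re := fun x => by
    rw [map_add, map_smul, hD, smul_zero, add_zero, hDv]
  have hv0 : (v : C(K, ℂ)) = 0 := eq_zero_of_exists_sameRay_add_I hv
    ((h.smul hz).exists_sameRay_of_map_eq_re hDzu hmax hDv)
    ((h.smul hz).exists_sameRay_of_map_eq_re hDzu hmax hDvI)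
  have hre : (D (z • u) m).re = 0 := by
    rw [← Complex.ofReal_eq_zero, ← hDv, show v = 0 from Subtype.ext hv0, map_zero,
      ContinuousMap.zero_apply]
  rw [hmax, Complex.ofReal_re] at hre
  exact hDzu (norm_eq_zero.1 hre)

end GraphNorm

section Tensor

variable {X Y : Type*} [TopologicalSpace X] [TopologicalSpace Y]

theorem tensor_one_eq (g : C(Y, ℂ)) :
    tensor (1 : C(X, ℂ)) g = ContinuousMap.compRightAlgHom ℂ ℂ ContinuousMap.snd g := by
  ext p; simp [tensor]

theorem tensor_one_one : tensor (1 : C(X, ℂ)) (1 : C(Y, ℂ)) = 1 := by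
  rw [tensor_one_eq, map_one]

variable [CompactSpace X] [CompactSpace Y]

theorem norm_tensor_one [Nonempty X] (g : C(Y, ℂ)) : ‖tensor (1 : C(X, ℂ)) g‖ = ‖g‖ := by
  refine le_antisymm ((ContinuousMap.norm_le _ (norm_nonneg _)).2 fun p => ?_)
    ((ContinuousMap.norm_le _ (norm_nonneg _)).2 fun y => ?_)
  · simpa [tensor] using g.norm_coe_le_norm p.2
  · obtain ⟨x⟩ := ‹Nonempty X›
    simpa [tensor] using (tensor (1 : C(X, ℂ)) g).norm_coe_le_norm (x, y)

theorem IsSpear.of_tensor_one [Nonempty X] {E : Type*} [SeminormedAddCommGroup E]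
    [NormedSpace ℂ E] {W : Submodule ℂ C(X × Y, ℂ)} {D : W →ₗ[ℂ] E}
    (hmem : ∀ g : C(Y, ℂ), tensor 1 g ∈ W)
    (hD : ∀ g : C(Y, ℂ), D ⟨tensor 1 g, hmem g⟩ = 0) {h : C(Y, ℂ)}
    (hh : IsSpear (graphNorm D) ⟨tensor 1 h, hmem h⟩) : IsSpear (normSeminorm ℂ C(Y, ℂ)) h := by
  let ι : C(Y, ℂ) →ₗ[ℂ] W :=
    (ContinuousMap.compRightAlgHom ℂ ℂ ContinuousMap.snd).toLinearMap.codRestrict W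
      fun g => tensor_one_eq (X := X) g ▸ hmem g
  have hι : ∀ g, ι g = ⟨tensor 1 g, hmem g⟩ := fun g => Subtype.ext (tensor_one_eq g).symm
  refine IsSpear.of_map (ι := ι) (q := graphNorm D) (fun g => ?_) (by rwa [hι])
  rw [hι, graphNorm_of_map_eq_zero (hD g)]
  exact norm_tensor_one g

end Tensor

end Valuezation

open Valuezation in
theorem proposition6p1_general {K X Y M E : Type*}
    [TopologicalSpace K] [CompactSpace K] [TopologicalSpace X] [CompactSpace X]
    [TopologicalSpace Y] [CompactSpace Y] [TopologicalSpace M] [CompactSpace M]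
    [SeminormedAddCommGroup E] [NormedSpace ℂ E]
    {W₁ : Submodule ℂ C(K, ℂ)} (hone : 1 ∈ W₁) {D₁ : W₁ →ₗ[ℂ] E} (hD₁ : D₁ ⟨1, hone⟩ = 0)
    {W₂ : Submodule ℂ C(X × Y, ℂ)} (hstar : ∀ F ∈ W₂, star F ∈ W₂)
    (hmem : ∀ g : C(Y, ℂ), tensor 1 g ∈ W₂) {D₂ : W₂ →ₗ[ℂ] C(M, ℂ)}
    (hker : ∀ F : W₂, D₂ F = 0 ↔ ∃ g : C(Y, ℂ), (F : C(X × Y, ℂ)) = tensor 1 g)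
    (hreal : ∀ F : W₂, (∀ p, ((F : C(X × Y, ℂ)) p).im = 0) → ∀ m, (D₂ F m).im = 0)
    {U : W₁ →ₗ[ℂ] W₂} (hU : Function.Surjective U)
    (hiso : ∀ F, graphNorm D₂ (U F) = graphNorm D₁ F) :
    ∃ h : C(Y, ℂ), (∀ y, ‖h y‖ = 1) ∧ (U ⟨1, hone⟩ : C(X × Y, ℂ)) = tensor 1 h := by
  have hone₂ : 1 ∈ W₂ := tensor_one_one (X := X) (Y := Y) ▸ hmem 1
  rcases isEmpty_or_nonempty (X × Y) with _ | hXY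
  · exact ⟨1, fun _ => norm_one, Subsingleton.elim _ _⟩
  have : Nonempty X := hXY.map Prod.fst
  have : Nonempty K := by
    by_contra hK
    rw [not_nonempty_iff] at hK
    have := hU.subsingleton
    exact one_ne_zero (congrArg Subtype.val (Subsingleton.elim (⟨1, hone₂⟩ : W₂) 0))
  have hspear : IsSpear (graphNorm D₂) (U ⟨1, hone⟩) :=
    (isSpear_graphNorm_one hone hD₁).map hU hiso
  have hDU : D₂ (U ⟨1, hone⟩) = 0 :=
    hspear.map_eq_zero hone₂ ((hker _).2 ⟨1, tensor_one_one.symm⟩) hstar hreal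
  obtain ⟨h, hh⟩ := (hker _).1 hDU
  have hh' : U ⟨1, hone⟩ = ⟨tensor 1 h, hmem h⟩ := Subtype.ext hh
  have hnorm : ‖h‖ = 1 := by
    have hU1 := hiso ⟨1, hone⟩
    rw [graphNorm_of_map_eq_zero hDU, graphNorm_of_map_eq_zero hD₁, hh'] at hU1
    simpa only [Submodule.coe_norm, norm_tensor_one, norm_one] using hU1
  have hspear_h : IsSpear (normSeminorm ℂ C(Y, ℂ)) h :=
    .of_tensor_one hmem (fun g => (hker _).2 ⟨g, rfl⟩) (hh' ▸ hspear)
  exact ⟨h, fun y => (hspear_h.norm_apply_eq_norm y).trans hnorm, hh⟩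

theorem proposition6p1
    {X₁ : Type u₁} {Y₁ : Type v₁} {X₂ : Type u₂} {Y₂ : Type v₂}
    [TopologicalSpace X₁] [CompactSpace X₁] [T2Space X₁]
    [TopologicalSpace Y₁] [CompactSpace Y₁] [T2Space Y₁]
    [TopologicalSpace X₂] [CompactSpace X₂] [T2Space X₂]
    [TopologicalSpace Y₂] [CompactSpace Y₂] [T2Space Y₂]
    [Nontrivial X₂]
    (B₁ : Subalgebra ℂ C(X₁, ℂ)) (NB₁ : AlgebraNorm ℂ B₁)
    (W₁ : Subalgebra ℂ C(X₁ × Y₁, ℂ)) (NW₁ : AlgebraNorm ℂ W₁)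
    (B₂ : Subalgebra ℂ C(X₂, ℂ)) (NB₂ : AlgebraNorm ℂ B₂)
    (W₂ : Subalgebra ℂ C(X₂ × Y₂, ℂ)) (NW₂ : AlgebraNorm ℂ W₂)
    (h₁ : Valuezation.IsNaturalValuezation.{w₁} B₁ NB₁ W₁ NW₁)
    (h₂ : Valuezation.IsNaturalValuezation.{w₂} B₂ NB₂ W₂ NW₂)
    (U : W₁ →ₗ[ℂ] W₂) (hU : Function.Surjective U)
    (hiso : ∀ F : W₁, NW₂ (U F) = NW₁ F) :
    ∃ h : C(Y₂, ℂ), (∀ y, ‖h y‖ = 1) ∧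
      ((U 1 : W₂) : C(X₂ × Y₂, ℂ)) = Valuezation.tensor 1 h := by
  obtain ⟨M₁, _, _, _, D₁, hker₁, -, hN₁⟩ := h₁.exists_map
  obtain ⟨M₂, _, _, _, D₂, hker₂, hreal₂, hN₂⟩ := h₂.exists_map
  exact proposition6p1_general (W₁ := Subalgebra.toSubmodule W₁) (W₂ := Subalgebra.toSubmodule W₂)
    W₁.one_mem ((hker₁ 1).2 ⟨1, Valuezation.tensor_one_one.symm⟩) h₂.total.selfAdjoint.2
    (fun g => h₂.tensor_le (Submodule.subset_span ⟨1, B₂.one_mem, g, trivial, rfl⟩))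
    hker₂ hreal₂ hU fun F => (hN₂ (U F)).symm.trans ((hiso F).trans (hN₁ F))
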